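/- A normal map (crossed module) is a group homomorphism $n\colon M\to G$ together with an action of $G$ on the group $M$ by automorphisms, written $a\mapsto a^g$, such that $n(a^g)=g^{-1}n(a)g$ and $a^{n(b)}=b^{-1}ab$ for all $a,b\in M$, $g\in G$. The free normal closure of a group homomorphism $\varphi\colon\Gamma\to G$ is the factorization $\Gamma\xrightarrow{c_\varphi}\Gamma^\varphi\xrightarrow{\widehat\varphi}G$ of $\varphi$ with $\widehat\varphi$ a normal map that is universal: for every factorization $\Gamma\xrightarrow{\psi}M\xrightarrow{n}G$ of $\varphi$ with $n$ a normal map there is a unique $G$-equivariant homomorphism $\widehat\psi\colon\Gamma^\varphi\to M$ with $n\circ\widehat\psi=\widehat\varphi$ and $\widehat\psi\circ c_\varphi=\psi$. (It exists and is unique up to isomorphism.) The normal closures tower of $\varphi$ is defined by $\Gamma_1=G$, $\varphi_1=\varphi$, and $\Gamma_{i+1}=\Gamma^{\varphi_i}$, $\varphi_{i+1}=c_{\varphi_i}\colon\Gamma\to\Gamma_{i+1}$ for $i\ge 1$, with connecting maps $\widehat{\varphi_i}\colon\Gamma_{i+1}\to\Gamma_i$. Theorem. Let $\Gamma$ and $G$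 be finite groups and let $\varphi\colon\Gamma\to G$ be a homomorphism such that the normal closure of $\varphi(\Gamma)$ in $G$ is $G$. Then the normal closures tower of $\varphi$ terminates after finitely many steps, that is, there is an $N$ such that $\widehat{\varphi_i}\colon\Gamma_{i+1}\to\Gamma_i$ is an isomorphism for all $i\ge N$. Moreover every term $\Gamma_i$, $i\ge 1$, is finite with $$|\Gamma_i|\le|\Gamma|\cdot f(|G|),\qquad f(t)=t^{(\log_p t+1)/2},$$ where $p$ is the least prime divisor of $t$, and $f(1)=1$. -/

import Mathlib

universe u v

/-- A normal structure (crossed module structure) on a group homomorphism `n : M →* G`: an action of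
`G` on the group `M` by automorphisms satisfying (NM1) and (NM2).
Actions are written on the left: `act g a` is `a` acted on by `g⁻¹` in the right-hand
notation `a ^ g`, so that conjugation is `g * a * g⁻¹` instead of `g⁻¹ * a * g`. -/
structure NormalStructure {M : Type u} {G : Type v} [Group M] [Group G] (n : M →* G) where
  act : G →* MulAut M
  map_act : ∀ (g : G) (a : M), n (act g a) = g * n a * g⁻¹
  act_map : ∀ a b : M, act (n b) a = b * a * b⁻¹

/-- `(M, c, n, s)` is a free normal closure of `φ : Γ →* G`: it is a factorization of `φ` as
`c : Γ →* M` followed by a normal map `n : M →* G` such that, for every other factorization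
of `φ` as `ψ : Γ →* M'` followed by a normal map `n' : M' →* G` (with normal structure `s'`),
there is a unique morphism `M →* M'` of normal maps over `G` that carries `c` to `ψ`. -/
def IsFreeNormalClosure {Γ G M : Type u} [Group Γ] [Group G] [Group M] (φ : Γ →* G)
    (c : Γ →* M) (n : M →* G) (s : NormalStructure n) : Prop :=
  n.comp c = φ ∧
  ∀ (M' : Type u) [Group M'] (ψ : Γ →* M') (n' : M' →* G) (s' : NormalStructure n'),
    n'.comp ψ = φ →
    ∃! f : M →* M', n'.comp f = n ∧ (∀ (g : G) (a : M), f (s.act g a) = s'.act g (f a)) ∧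
      f.comp c = ψ

/-! ### Construction of the free normal closure by generators and relations -/

section Construction

variable {Γ G : Type u} [Group Γ] [Group G]

/-- The relations, on symbols `(γ, g)` standing for `g` acting on `γ`:
`(γ, g) (δ, g) = (γ δ, g)` and
`(δ, h) (γ, g) (δ, h)⁻¹ = (γ, h φ(δ) h⁻¹ g)`.
(The first family contains `(1, g) (1, g) = (1, g)`, that is, `(1, g) = 1`.) -/
inductive FreeNormalClosure.IsRel (φ : Γ →* G) : FreeGroup (Γ × G) → Prop
  | mul (γ δ : Γ) (g : G) : IsRel φ
      (FreeGroup.of (γ, g) * FreeGroup.of (δ, g) * (FreeGroup.of (γ * δ, g))⁻¹)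
  | conj (γ δ : Γ) (g h : G) : IsRel φ
      (FreeGroup.of (δ, h) * FreeGroup.of (γ, g) * (FreeGroup.of (δ, h))⁻¹ *
        (FreeGroup.of (γ, h * φ δ * h⁻¹ * g))⁻¹)

/-- The group `Γ^φ` underlying the free normal closure of `φ`. -/
abbrev FreeNormalClosure (φ : Γ →* G) : Type u :=
  PresentedGroup {r | FreeNormalClosure.IsRel φ r}

namespace FreeNormalClosure

variable (φ : Γ →* G)

/-- The class in `Γ^φ` of the symbol `(γ, g)`. -/
def mk (γ : Γ) (g : G) : FreeNormalClosure φ := PresentedGroup.of (γ, g)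

theorem mk_mul (γ δ : Γ) (g : G) : mk φ (γ * δ) g = mk φ γ g * mk φ δ g := by
  have h := PresentedGroup.one_of_mem (rels := {r | IsRel φ r}) (IsRel.mul γ δ g)
  simp only [map_mul, map_inv] at h
  exact (mul_inv_eq_one.mp h).symm

theorem mk_conj (γ δ : Γ) (g h : G) :
    mk φ δ h * mk φ γ g * (mk φ δ h)⁻¹ = mk φ γ (h * φ δ * h⁻¹ * g) := by
  have h := PresentedGroup.one_of_mem (rels := {r | IsRel φ r}) (IsRel.conj γ δ g h)
  simp only [map_mul, map_inv] at h
  exact mul_inv_eq_one.mp h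

/-- A function on symbols that respects the relations extends to a homomorphism on `Γ^φ`. -/
def lift {M : Type v} [Group M] (F : Γ → G → M)
    (hmul : ∀ γ δ g, F (γ * δ) g = F γ g * F δ g)
    (hconj : ∀ γ δ g h, F δ h * F γ g * (F δ h)⁻¹ = F γ (h * φ δ * h⁻¹ * g)) :
    FreeNormalClosure φ →* M :=
  PresentedGroup.toGroup (f := fun x : Γ × G => F x.1 x.2) (by
    rintro r (⟨γ, δ, g⟩ | ⟨γ, δ, g, h⟩)
    · simp [hmul]
    · simp [hconj])

@[simp] theorem lift_mk {M : Type v} [Group M] (F : Γ → G → M) (hmul hconj) (γ : Γ) (g : G) :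
    lift φ F hmul hconj (mk φ γ g) = F γ g :=
  PresentedGroup.toGroup.of _

theorem hom_ext {M : Type v} [Group M] {f f' : FreeNormalClosure φ →* M}
    (h : ∀ γ g, f (mk φ γ g) = f' (mk φ γ g)) : f = f' :=
  PresentedGroup.ext fun x => h x.1 x.2

/-- The map `c_φ : Γ → Γ^φ`. -/
def incl : Γ →* FreeNormalClosure φ :=
  MonoidHom.mk' (fun γ => mk φ γ 1) fun γ δ => mk_mul φ γ δ 1

/-- The normal map `Γ^φ → G`. -/
def proj : FreeNormalClosure φ →* G :=
  lift φ (fun γ g => g * φ γ * g⁻¹) (fun γ δ g => by simp [mul_assoc])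
    (fun γ δ g h => by simp [mul_assoc])

@[simp] theorem proj_mk (γ : Γ) (g : G) : proj φ (mk φ γ g) = g * φ γ * g⁻¹ :=
  lift_mk φ _ _ _ γ g

/-- The action of one element of `G` on `Γ^φ`. -/
def actHom (k : G) : FreeNormalClosure φ →* FreeNormalClosure φ :=
  lift φ (fun γ g => mk φ γ (k * g)) (fun γ δ g => mk_mul φ γ δ (k * g))
    (fun γ δ g h => by rw [mk_conj]; congr 1; simp [mul_assoc])

@[simp] theorem actHom_mk (k : G) (γ : Γ) (g : G) :
    actHom φ k (mk φ γ g) = mk φ γ (k * g) :=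
  lift_mk φ _ _ _ γ g

theorem actHom_one : actHom φ 1 = MonoidHom.id _ := hom_ext φ fun γ g => by simp

theorem actHom_mul (k l : G) : actHom φ (k * l) = (actHom φ k).comp (actHom φ l) :=
  hom_ext φ fun γ g => by simp [mul_assoc]

/-- The action of `G` on `Γ^φ`. -/
def act : G →* MulAut (FreeNormalClosure φ) :=
  MonoidHom.mk' (fun k =>
    MonoidHom.toMulEquiv (actHom φ k) (actHom φ k⁻¹)
      (by rw [← actHom_mul, inv_mul_cancel, actHom_one])
      (by rw [← actHom_mul, mul_inv_cancel, actHom_one]))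
    fun k l => MulEquiv.ext fun x => DFunLike.congr_fun (actHom_mul φ k l) x

@[simp] theorem act_mk (k : G) (γ : Γ) (g : G) : act φ k (mk φ γ g) = mk φ γ (k * g) :=
  actHom_mk φ k γ g

/-- The normal structure on `Γ^φ → G`. -/
def normalStructure : NormalStructure (proj φ) where
  act := act φ
  map_act k a := by
    have : (proj φ).comp (act φ k).toMonoidHom = (MulAut.conj k).toMonoidHom.comp (proj φ) :=
      hom_ext φ fun γ g => by simp [mul_assoc]
    exact DFunLike.congr_fun this a
  act_map a b := by
    have key : (act φ).comp (proj φ) = MulAut.conj := by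
      refine hom_ext φ fun δ h => ?_
      have : ((act φ) (proj φ (mk φ δ h))).toMonoidHom = (MulAut.conj (mk φ δ h)).toMonoidHom :=
        hom_ext φ fun γ g => by
          change act φ (proj φ (mk φ δ h)) (mk φ γ g) = mk φ δ h * mk φ γ g * (mk φ δ h)⁻¹
          rw [proj_mk, act_mk, mk_conj]
      exact MulEquiv.ext fun x => DFunLike.congr_fun this x
    exact DFunLike.congr_fun (DFunLike.congr_fun key b) a

/-- The construction has the universal property of the free normal closure. -/
theorem isFreeNormalClosure :
    IsFreeNormalClosure φ (incl φ) (proj φ) (normalStructure φ) := by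
  refine ⟨MonoidHom.ext fun γ => by simp [incl], ?_⟩
  intro M' _ ψ n' s' hψ
  have hn (γ : Γ) : n' (ψ γ) = φ γ := DFunLike.congr_fun hψ γ
  let f : FreeNormalClosure φ →* M' := lift φ (fun γ g => s'.act g (ψ γ))
    (fun γ δ g => by simp)
    (fun γ δ g h => by
      rw [← s'.act_map, s'.map_act, hn, ← MulAut.mul_apply, ← map_mul])
  have hf (γ : Γ) (g : G) : f (mk φ γ g) = s'.act g (ψ γ) := lift_mk φ _ _ _ γ g
  refine ⟨f, ⟨?_, ?_, ?_⟩, ?_⟩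
  · exact hom_ext φ fun γ g => by simp [hf, s'.map_act, hn]
  · intro k a
    have : f.comp (act φ k).toMonoidHom = (s'.act k).toMonoidHom.comp f :=
      hom_ext φ fun γ g => by simp [hf]
    exact DFunLike.congr_fun this a
  · exact MonoidHom.ext fun γ => by simp [incl, hf]
  · rintro f' ⟨-, h2, h3⟩
    refine hom_ext φ fun γ g => ?_
    have h : f' (mk φ γ 1) = ψ γ := DFunLike.congr_fun h3 γ
    have h' := h2 g (mk φ γ 1)
    rw [h] at h'
    rw [hf, ← h']
    simp [normalStructure]

end FreeNormalClosure

end Construction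

/-! ### The tower of free normal closures -/

/-- A group together with a homomorphism from `Γ` to it. -/
structure GroupUnder (Γ : Type u) [Group Γ] where
  carrier : Type u
  [group : Group carrier]
  hom : Γ →* carrier

attribute [instance] GroupUnder.group

/-- The free normal closures tower of `φ : Γ →* G`, numbered from `0`. The stage `0` is `φ` itself
and the stage `i + 1` is the map `Γ → Γ^(φ_i)` of the free normal closure of the stage `i`,
`φ_i`. -/
def normalClosuresTower {Γ G : Type u} [Group Γ] [Group G] (φ : Γ →* G) : ℕ → GroupUnder Γ
  | 0 => ⟨G, φ⟩
  | i + 1 => ⟨FreeNormalClosure (normalClosuresTower φ i).hom,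
      FreeNormalClosure.incl (normalClosuresTower φ i).hom⟩

/-- The normal map from the stage `i + 1` of the tower to the stage `i`. -/
def normalClosuresTower.map {Γ G : Type u} [Group Γ] [Group G] (φ : Γ →* G) (i : ℕ) :
    (normalClosuresTower φ (i + 1)).carrier →* (normalClosuresTower φ i).carrier :=
  FreeNormalClosure.proj (normalClosuresTower φ i).hom

/-- `f(t) = t ^ ((log_p t + 1) / 2)`, where `p` is the least prime divisor of `t`.
At `t = 1`, which has no prime divisor, the value is `1`. -/
noncomputable def towerBound (t : ℕ) : ℝ :=
  (t : ℝ) ^ ((Real.logb (t.minFac : ℝ) (t : ℝ) + 1) / 2)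

open Subgroup hiding commutator commutator_def

open scoped commutatorElement

/-! Each connecting map is onto with central kernel, so a stage `H` of the tower maps to `G` with
hypercentral kernel, and `H` is still normally generated by the image of `Γ`. Let `R` be the last
term of the lower central series of `H`. In a nilpotent group a normally generating subgroup is
everything, so `Γ` maps onto `H ⧸ R` and `|H : R| ≤ |Γ|`.

The part `N` of the kernel inside `R` is central in `R`
(`commutator_lowerCentralSeries_upperCentralSeries`) and lies in `[R, R]`
(`lowerCentralSeries_inf_upperCentralSeries_le`). As for Schur multipliers, transfer to Sylow
subgroups and a bound on derived subgroups of `p`-groups control `|N|` in terms of `|R : N|`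
(`factorization_card_le_choose`), and `R ⧸ N` embeds in `G`. This bounds `|R|` by `towerBound |G|`,
hence `|H|` independently of the stage. The orders increase along the tower, so they stabilize, and
surjections between finite groups of equal order are bijective. -/

/-! ### Derived subgroups of finite `p`-groups. -/

theorem Subgroup.card_le_card_ker_mul_card_map {G G' : Type*} [Group G] [Group G'] [Finite G]
    (f : G →* G') (H : Subgroup G) : Nat.card H ≤ Nat.card f.ker * Nat.card (H.map f) := by
  rw [← card_mul_index (f.comp H.subtype).ker, index_ker, MonoidHom.range_comp, range_subtype]
  refine Nat.mul_le_mul_right _ (Nat.card_le_card_of_injective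
    (fun x => (⟨x.1.1, x.2⟩ : f.ker)) fun x y h => ?_)
  exact Subtype.ext (Subtype.ext (congrArg (fun z : f.ker => (z : G)) h))

theorem IsPGroup.mul_index_le_index {p : ℕ} {G : Type*} [Group G] [Finite G]
    [Fact p.Prime] (hG : IsPGroup p G) {H K : Subgroup G} (h : H < K) :
    p * K.index ≤ H.index := by
  rw [← relIndex_mul_index h.le]
  refine Nat.mul_le_mul_right _ (Nat.le_of_dvd (Nat.pos_of_ne_zero index_ne_zero_of_finite) ?_)
  obtain ⟨n, hn⟩ := (hG.to_subgroup K).index (H.subgroupOf K)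
  rw [relIndex, hn]
  refine dvd_pow_self p fun h0 => h.not_ge ?_
  rwa [h0, pow_zero, index_eq_one, subgroupOf_eq_top] at hn

/-- If every commutator of `x` is central, then `a ↦ ⁅x, a⁆` is a homomorphism. -/
def commutatorHom {G : Type*} [Group G] (x : G) (hx : ∀ a, ⁅x, a⁆ ∈ center G) : G →* G :=
  MonoidHom.mk' (fun a => ⁅x, a⁆) fun a b => by
    rw [commutatorElement_mul_right_eq_mul_conj]
    have := mem_center_iff.mp (hx b) a
    simp [mul_assoc, this]

/-- A finite `p`-group whose center has index at most `p ^ n` has derived subgroup of order at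
most `p ^ (n choose 2)`. -/
theorem IsPGroup.card_commutator_le {p : ℕ} [Fact p.Prime] (n : ℕ) :
    ∀ {G : Type u} [Group G] [Finite G], IsPGroup p G → (center G).index ≤ p ^ n →
      Nat.card (commutator G) ≤ p ^ n.choose 2 := by
  have hp := (Fact.out : p.Prime)
  induction n with
  | zero =>
    intro G _ _ _ h
    have h1 : (center G).index = 1 :=
      le_antisymm (by simpa using h) (Nat.pos_of_ne_zero index_ne_zero_of_finite)
    rw [(commutator_eq_bot_iff_center_eq_top G).mpr (index_eq_one.mp h1)]
    simp
  | succ n ih =>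
    intro G _ _ hG h
    by_cases hc : center G = ⊤
    · rw [(commutator_eq_bot_iff_center_eq_top G).mpr hc]
      simpa using Nat.one_le_pow _ _ hp.pos
    have : Nontrivial (G ⧸ center G) := QuotientGroup.nontrivial_iff.mpr hc
    have := (hG.to_quotient (center G)).center_nontrivial
    -- Take `x` in the second center but not in the center. The image of `a ↦ ⁅x, a⁆` is central,
    -- and its kernel contains the center and `x`, so the image has order at most `p ^ n`. Modulo
    -- this image `x` becomes central, so the center of the quotient has index at most `p ^ n` and
    -- induction applies.
    obtain ⟨⟨y, hy⟩, hy1⟩ := exists_ne (1 : center (G ⧸ center G))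
    obtain ⟨x, rfl⟩ := QuotientGroup.mk_surjective y
    have hxZ : x ∉ center G := fun hx => hy1 (Subtype.ext ((QuotientGroup.eq_one_iff x).mpr hx))
    have hx (a : G) : ⁅x, a⁆ ∈ center G := by
      rw [← QuotientGroup.eq_one_iff]
      change ⁅(x : G ⧸ center G), (a : G ⧸ center G)⁆ = 1
      rw [commutatorElement_eq_one_iff_mul_comm]
      exact (mem_center_iff.mp hy _).symm
    let f := commutatorHom x hx
    have hf (a : G) : f a = ⁅x, a⁆ := rfl
    have hB : f.range ≤ center G := by
      rintro _ ⟨a, rfl⟩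
      exact hx a
    have : f.range.Normal := ⟨fun b hb g => by
      rwa [mem_center_iff.mp (hB hb) g, mul_inv_cancel_right]⟩
    have hcard : Nat.card f.range ≤ p ^ n := by
      rw [← index_ker]
      have hlt : center G < f.ker := by
        refine lt_of_le_of_ne (fun z hz => ?_) fun he => hxZ ?_
        · rw [MonoidHom.mem_ker, hf, commutatorElement_eq_one_iff_mul_comm]
          exact mem_center_iff.mp hz x
        · rw [he, MonoidHom.mem_ker, hf, commutatorElement_self]
      have := (hG.mul_index_le_index hlt).trans h
      rw [pow_succ'] at this
      exact Nat.le_of_mul_le_mul_left this hp.pos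
    have hquot : (center (G ⧸ f.range)).index ≤ p ^ n := by
      rw [← index_comap_of_surjective _ (QuotientGroup.mk'_surjective f.range)]
      have hlt : center G < (center (G ⧸ f.range)).comap (QuotientGroup.mk' f.range) := by
        refine lt_of_le_of_ne (fun z hz => ?_) fun he => hxZ ?_
        · rw [mem_comap, mem_center_iff]
          refine QuotientGroup.mk_surjective.forall.mpr fun g => ?_
          exact congrArg (QuotientGroup.mk' f.range) (mem_center_iff.mp hz g)
        · rw [he, mem_comap, mem_center_iff]
          refine QuotientGroup.mk_surjective.forall.mpr fun g => ?_
          have : ((⁅x, g⁆ : G) : G ⧸ f.range) = 1 := (QuotientGroup.eq_one_iff _).mpr ⟨g, rfl⟩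
          exact (commutatorElement_eq_one_iff_mul_comm.mp this).symm
      have := (hG.mul_index_le_index hlt).trans h
      rw [pow_succ'] at this
      exact Nat.le_of_mul_le_mul_left this hp.pos
    calc Nat.card (commutator G)
        ≤ Nat.card (QuotientGroup.mk' f.range).ker *
          Nat.card ((commutator G).map (QuotientGroup.mk' f.range)) :=
          card_le_card_ker_mul_card_map _ _
      _ ≤ p ^ n * p ^ n.choose 2 := by
          rw [QuotientGroup.ker_mk', commutator_def, map_commutator,
            map_top_of_surjective _ (QuotientGroup.mk'_surjective _), ← commutator_def]
          exact Nat.mul_le_mul hcard (ih (hG.to_quotient _) hquot)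
      _ = p ^ (n + 1).choose 2 := by
          rw [← pow_add, Nat.choose_succ_succ' n 1, Nat.choose_one_right]

/-! ### Central subgroups of the derived subgroup, by transfer. -/

/-- A central element of the derived subgroup that lies in a Sylow `p`-subgroup `P` lies in the
derived subgroup of `P`. -/
theorem Sylow.mem_commutator_of_mem_center {p : ℕ} [Fact p.Prime] {G : Type*} [Group G] [Finite G]
    (P : Sylow p G) {z : G} (hzP : z ∈ P) (hzc : z ∈ center G) (hz : z ∈ commutator G) :
    (⟨z, hzP⟩ : P) ∈ commutator P := by
  -- The target is commutative, so `T z = 1`; as `z` is central, `T z` is also the class of `z ^ |G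
  -- : P|`. The index is prime to the order of `z`, so `z` is a power of `z ^ |G : P|`.
  let T : G →* Abelianization P := MonoidHom.transfer (H := (P : Subgroup G)) Abelianization.of
  have hconj (k : ℕ) (g : G) : g⁻¹ * z ^ k * g = z ^ k := by
    rw [mul_assoc, ← mem_center_iff.mp (pow_mem hzc k) g, inv_mul_cancel_left]
  have hT := MonoidHom.transfer_eq_pow (H := (P : Subgroup G)) (A := Abelianization P)
    Abelianization.of z fun k g _ => hconj k g
  have h1 : T z = 1 := Abelianization.commutator_subset_ker T hz
  change T z = _ at hT
  rw [h1, eq_comm, ← MonoidHom.mem_ker, Abelianization.ker_of] at hT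
  have hcop : (Nat.card P).Coprime (P : Subgroup G).index := P.card_coprime_index
  have hord : (orderOf (⟨z, hzP⟩ : P)).Coprime (P : Subgroup G).index :=
    Nat.Coprime.coprime_dvd_left (orderOf_dvd_natCard _) hcop
  obtain ⟨m, hm⟩ := exists_pow_eq_self_of_coprime hord.symm
  rw [← hm]
  exact pow_mem hT m

/-- Bound for the order of a central subgroup contained in the derived subgroup. -/
theorem Subgroup.factorization_card_le_choose {G : Type u} [Group G] [Finite G] {N : Subgroup G}
    (hNc : N ≤ center G) (hN : N ≤ _root_.commutator G) (p : ℕ) :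
    (Nat.card N).factorization p ≤ (N.index.factorization p).choose 2 := by
  by_cases hp : p.Prime
  swap
  · simp [Nat.factorization_eq_zero_of_not_prime _ hp]
  have : Fact p.Prime := ⟨hp⟩
  -- Inside a Sylow subgroup `P` of `G`, the Sylow subgroup of `N` becomes a central subgroup `D` of
  -- `P` lying in `[P, P]`. The bound for `p`-groups then applies with exponent `v_p |G : N|`.
  obtain ⟨Q⟩ : Nonempty (Sylow p N) := inferInstance
  obtain ⟨P, hQP⟩ := (Q.isPGroup'.map N.subtype).exists_le_sylow
  have hQ : ∀ z ∈ (Q : Subgroup N).map N.subtype, z ∈ N := by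
    rintro _ ⟨z, _, rfl⟩
    exact z.2
  set D := ((Q : Subgroup N).map N.subtype).subgroupOf P with hD
  have hDcard : Nat.card D = p ^ (Nat.card N).factorization p := by
    rw [← Q.card_eq_multiplicity, hD, Nat.card_congr (subgroupOfEquivOfLe hQP).toEquiv]
    exact (Nat.card_congr ((Q : Subgroup N).equivMapOfInjective _ N.subtype_injective).toEquiv).symm
  have hDc : D ≤ center P := fun z hz => mem_center_iff.mpr fun g =>
    Subtype.ext (mem_center_iff.mp (hNc (hQ z hz)) g)
  have hD' : D ≤ _root_.commutator P := fun z hz =>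
    P.mem_commutator_of_mem_center z.2 (hNc (hQ z hz)) (hN (hQ z hz))
  have hDi : D.index = p ^ N.index.factorization p := by
    have h1 := D.card_mul_index
    rw [hDcard, P.card_eq_multiplicity, ← N.card_mul_index,
      Nat.factorization_mul Nat.card_pos.ne' index_ne_zero_of_finite, Finsupp.add_apply,
      pow_add] at h1
    exact Nat.eq_of_mul_eq_mul_left (pow_pos hp.pos _) h1
  have h2 := P.isPGroup'.card_commutator_le _ ((index_antitone hDc).trans hDi.le)
  rw [← Nat.pow_le_pow_iff_right hp.one_lt, ← hDcard]
  exact (card_le_of_le hD').trans h2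

/-! ### Lower and upper central series. -/

namespace Subgroup

/-- A subgroup that is not contained in any proper normal subgroup supplements every term of the
lower central series. -/
theorem sup_lowerCentralSeries_eq_top {G : Type*} [Group G] {L : Subgroup G}
    (h : normalClosure (L : Set G) = ⊤) (n : ℕ) :
    L ⊔ (⊤ : Subgroup G).lowerCentralSeries n = ⊤ := by
  induction n with
  | zero => simp
  | succ n ih =>
    -- Both `L` and the `n`-th term normalize `S`; by induction they generate `G`, so `S` is normal.
    set S := L ⊔ (⊤ : Subgroup G).lowerCentralSeries (n + 1)
    have hL : L ≤ normalizer (S : Set G) := le_sup_left.trans le_normalizer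
    have hC : (⊤ : Subgroup G).lowerCentralSeries n ≤ normalizer (S : Set G) := by
      rw [le_normalizer_iff_commutator_le_right]
      exact (commutator_mono le_rfl le_top).trans le_sup_right
    have hS : S.Normal := normalizer_eq_top_iff.mp (top_le_iff.mp (ih ▸ sup_le hL hC))
    exact top_le_iff.mp (h ▸ normalClosure_le_normal (le_sup_left : L ≤ S))

/-- Three subgroups lemma. One rotated commutator vanishes by induction in `G`, the other by
induction in `G ⧸ center G`, which is why `G` is quantified inside. -/
theorem commutator_lowerCentralSeries_upperCentralSeries (n : ℕ) :
    ∀ (G : Type u) [Group G],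
      ⁅(⊤ : Subgroup G).lowerCentralSeries n, upperCentralSeries G (n + 1)⁆ = ⊥ := by
  induction n with
  | zero =>
    intro G _
    rw [zero_add, upperCentralSeries_one, lowerCentralSeries_zero, commutator_center_right]
  | succ n ih =>
    intro G _
    rw [lowerCentralSeries_succ]
    apply commutator_commutator_eq_bot_of_rotate
    · rw [commutator_comm ⊤, eq_bot_iff, ← ih G, commutator_comm]
      exact commutator_mono le_rfl (commutator_upperCentralSeries_top_le G (n + 1))
    · rw [commutator_top_right_eq_bot_iff_le_center, ← QuotientGroup.ker_mk' (center G),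
        ← map_eq_bot_iff, map_commutator, eq_bot_iff, ← ih (G ⧸ center G), commutator_comm,
        map_lowerCentralSeries, map_top_of_surjective _ (QuotientGroup.mk'_surjective _)]
      refine commutator_mono le_rfl ?_
      rw [map_le_iff_le_comap, comap_upperCentralSeries_quotient_center]

/-- Let `A` be a finite commutative normal subgroup on which `G` acts as a nilpotent group. If
`⁅A, G⁆ = A`, then no nontrivial element of `A` is central. -/
theorem inf_center_eq_bot_of_commutator_eq (k : ℕ) :
    ∀ {G : Type u} [Group G] (A : Subgroup G) [A.Normal] [Finite A], Nat.card A ≤ k →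
      A ≤ centralizer A → (∃ n, (⊤ : Subgroup G).lowerCentralSeries n ≤ centralizer A) →
      ⁅A, ⊤⁆ = A → A ⊓ center G = ⊥ := by
  classical
  induction k with
  | zero =>
    intro G _ A _ _ h
    exact absurd h Nat.card_pos.not_ge
  | succ k ih =>
    intro G _ A hAn _ hk hA hn hAG
    rcases hfind : Nat.find hn with _ | m
    · have h := Nat.find_spec hn
      rw [hfind, lowerCentralSeries_zero, ← commutator_eq_bot_iff_le_centralizer,
        commutator_comm, hAG] at h
      rw [h, bot_inf_eq]
    have hm : (⊤ : Subgroup G).lowerCentralSeries (m + 1) ≤ centralizer A :=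
      hfind ▸ Nat.find_spec hn
    -- The action of `x` on `A` is nontrivial but central in the group of automorphisms induced by
    -- `G`, so `a ↦ ⁅x, a⁆` is a `G`-equivariant endomorphism of `A`.
    obtain ⟨x, hxm, hxA⟩ := SetLike.not_le_iff_exists.mp (Nat.find_min hn (m := m) (by omega))
    have hcomm {a b : G} (ha : a ∈ A) (hb : b ∈ A) : a * b = b * a :=
      (mem_centralizer_iff.mp (hA ha) b hb).symm
    have hxa {a : G} (ha : a ∈ A) : ⁅x, a⁆ ∈ A :=
      mul_mem (hAn.conj_mem a ha x) (inv_mem ha)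
    let θ : A →* G := MonoidHom.mk' (fun a => ⁅x, (a : G)⁆) fun a b => by
      rw [coe_mul, commutatorElement_mul_right_eq_mul_conj, mul_assoc, mul_assoc,
        ← mul_assoc (a : G), hcomm a.2 (hxa b.2), mul_inv_cancel_right]
    have hθ (a : A) : θ a = ⁅x, (a : G)⁆ := rfl
    have hconj (a : A) (g : G) : θ ⟨g * a * g⁻¹, hAn.conj_mem a a.2 g⟩ = g * θ a * g⁻¹ := by
      have hd : ⁅x⁻¹, g⁻¹⁆ ∈ centralizer (A : Set G) :=
        hm (commutator_mem_commutator (inv_mem hxm) (mem_top _))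
      have hd' := mem_centralizer_iff.mp hd a a.2
      have h1 : x * g = g * x * ⁅x⁻¹, g⁻¹⁆ := by simp [commutatorElement_def, mul_assoc]
      calc ⁅x, g * a * g⁻¹⁆ = (x * g) * a * (x * g)⁻¹ * (g * (a : G)⁻¹ * g⁻¹) := by
            simp [commutatorElement_def, mul_assoc]
        _ = g * x * (⁅x⁻¹, g⁻¹⁆ * a) * ⁅x⁻¹, g⁻¹⁆⁻¹ * x⁻¹ * (a : G)⁻¹ * g⁻¹ := by
            rw [h1]
            simp only [mul_inv_rev, mul_assoc, inv_mul_cancel_left]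
        _ = g * θ a * g⁻¹ := by
            rw [← hd', hθ, commutatorElement_def x]
            simp only [mul_assoc, mul_inv_cancel_left]
    set B := θ.range with hB
    have hBA : B ≤ A := by
      rintro _ ⟨a, rfl⟩
      exact hxa a.2
    have hBn : B.Normal := ⟨by
      rintro _ ⟨a, rfl⟩ g
      exact ⟨_, hconj a g⟩⟩
    have hBG : ⁅B, ⊤⁆ = B := by
      refine le_antisymm (commutator_le_left B ⊤) ?_
      -- By equivariance `θ` sends `⁅A, G⁆`, which is all of `A`, into `⁅B, G⁆`.
      have h : ⁅A, (⊤ : Subgroup G)⁆ ≤ (⁅B, (⊤ : Subgroup G)⁆.comap θ).map A.subtype := by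
        refine commutator_le.mpr fun a ha g _ => ?_
        refine ⟨⟨a, ha⟩ * ⟨g * (⟨a, ha⟩⁻¹ : A) * g⁻¹, hAn.conj_mem _ (SetLike.coe_mem _) g⟩,
          ?_, by simp [commutatorElement_def, mul_assoc]⟩
        rw [SetLike.mem_coe, mem_comap, map_mul, hconj, map_inv, ← mul_assoc, ← mul_assoc]
        exact commutator_mem_commutator ⟨_, rfl⟩ (mem_top g)
      rw [hAG] at h
      rintro _ ⟨a, rfl⟩
      obtain ⟨b, hb, hba⟩ := h a.2
      obtain rfl : b = a := Subtype.ext hba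
      exact hb
    rw [eq_bot_iff]
    rintro z ⟨hzA, hzc⟩
    rw [SetLike.mem_coe] at hzA hzc
    -- If `B = A`, then `θ` is injective by finiteness, yet it kills central elements. Otherwise `B`
    -- and `A ⧸ B` are both smaller than `A` (`B ≠ 1` by the choice of `x`): induction in the
    -- quotient puts `z` in `B`, and induction in `B` makes it trivial.
    rcases hBA.eq_or_lt with hAB | hAB
    · have hinj : Function.Injective (θ.codRestrict A fun a => hxa a.2) := by
        rw [Finite.injective_iff_surjective]
        rintro ⟨a, ha⟩
        rw [← hAB] at ha
        obtain ⟨b, rfl⟩ := ha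
        exact ⟨b, rfl⟩
      have h1 : θ.codRestrict A (fun a => hxa a.2) ⟨z, hzA⟩ = 1 :=
        Subtype.ext (commutatorElement_eq_one_iff_mul_comm.mpr (mem_center_iff.mp hzc x))
      rw [← map_one (θ.codRestrict A fun a => hxa a.2)] at h1
      exact congrArg Subtype.val (hinj h1)
    · have : Finite B := Finite.of_injective _ (inclusion_injective hBA)
      have hBcard : Nat.card B < Nat.card A :=
        Set.ncard_lt_ncard (SetLike.coe_ssubset_coe.mpr hAB) (Set.toFinite _)
      have hBc := ih B (by omega) (hBA.trans (hA.trans (centralizer_le hBA)))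
        ⟨_, hm.trans (centralizer_le hBA)⟩ hBG
      let q := QuotientGroup.mk' B
      have hmapc {C : Subgroup G} (hC : C ≤ centralizer A) : C.map q ≤ centralizer (A.map q) := by
        rw [← commutator_eq_bot_iff_le_centralizer] at hC ⊢
        rw [← map_commutator, hC, map_bot]
      have hBne : 1 < Nat.card B := by
        rw [one_lt_card_iff_ne_bot]
        intro h
        refine hxA (mem_centralizer_iff.mpr fun a ha => ?_)
        have : θ ⟨a, ha⟩ = 1 := by
          rw [← mem_bot, ← h]
          exact ⟨_, rfl⟩
        exact (commutatorElement_eq_one_iff_mul_comm.mp this).symm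
      have hqn : (A.map q).Normal := hAn.map q (QuotientGroup.mk'_surjective B)
      have : Finite (A.map q) := Finite.of_surjective _ (q.subgroupMap_surjective A)
      have hqcard : Nat.card (A.map q) < Nat.card A := by
        have h1 := (q.comp A.subtype).ker.index_mul_card
        rw [index_ker, MonoidHom.range_comp, range_subtype] at h1
        have h2 : Nat.card (q.comp A.subtype).ker = Nat.card B := by
          rw [← MonoidHom.comap_ker, QuotientGroup.ker_mk']
          exact Nat.card_congr (subgroupOfEquivOfLe hBA).toEquiv
        rw [← h1, h2]
        exact lt_mul_of_one_lt_right Nat.card_pos hBne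
      have hqc := ih (A.map q) (by omega) (hmapc hA) ⟨m + 1, by
          rw [← map_top_of_surjective q (QuotientGroup.mk'_surjective B),
            ← map_lowerCentralSeries]
          exact hmapc hm⟩ (by
          rw [← map_top_of_surjective q (QuotientGroup.mk'_surjective B), ← map_commutator, hAG])
      have hzB : z ∈ B := by
        rw [← QuotientGroup.eq_one_iff, ← mem_bot, ← hqc]
        refine ⟨⟨z, hzA, rfl⟩, mem_center_iff.mpr ?_⟩
        exact QuotientGroup.mk_surjective.forall.mpr fun g =>
          congrArg q (mem_center_iff.mp hzc g)
      rw [← hBc]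
      exact ⟨hzB, hzc⟩

/-- A normal subgroup without nontrivial central elements meets the terms of the upper central
series trivially. -/
theorem inf_upperCentralSeries_eq_bot {G : Type*} [Group G] {A : Subgroup G} [A.Normal]
    (hA : A ⊓ center G = ⊥) (n : ℕ) : A ⊓ upperCentralSeries G n = ⊥ := by
  induction n with
  | zero => rw [upperCentralSeries_zero, inf_bot_eq]
  | succ n ih =>
    rw [eq_bot_iff, ← hA]
    refine le_inf inf_le_left ?_
    rw [← commutator_top_right_eq_bot_iff_le_center, eq_bot_iff, ← ih]
    exact le_inf ((commutator_mono inf_le_left le_rfl).trans (commutator_le_left A ⊤))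
      ((commutator_mono inf_le_right le_rfl).trans (commutator_upperCentralSeries_top_le G n))

/-- If the lower central series of a finite group is stationary from `n` on, then the intersection
of its final term `R` with the terms of the upper central series lies in `⁅R, R⁆`. -/
theorem lowerCentralSeries_inf_upperCentralSeries_le {G : Type u} [Group G] [Finite G] {n : ℕ}
    (hn : (⊤ : Subgroup G).lowerCentralSeries (n + 1) = (⊤ : Subgroup G).lowerCentralSeries n)
    (m : ℕ) :
    (⊤ : Subgroup G).lowerCentralSeries n ⊓ upperCentralSeries G m ≤
      ⁅(⊤ : Subgroup G).lowerCentralSeries n, (⊤ : Subgroup G).lowerCentralSeries n⁆ := by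
  set R := (⊤ : Subgroup G).lowerCentralSeries n with hR
  let q := QuotientGroup.mk' ⁅R, R⁆
  have hq : Function.Surjective q := QuotientGroup.mk'_surjective _
  have : (R.map q).Normal := Normal.map inferInstance q hq
  -- Modulo `[R, R]` the image of `R` is abelian, is itself the `n`-th lower central term, and
  -- equals its commutator with the whole group.
  have hRc : R.map q ≤ centralizer (R.map q) := by
    rw [← commutator_eq_bot_iff_le_centralizer, ← map_commutator, map_eq_bot_iff,
      QuotientGroup.ker_mk']
  have hc : R.map q ⊓ center (G ⧸ ⁅R, R⁆) = ⊥ := by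
    refine inf_center_eq_bot_of_commutator_eq _ (R.map q) le_rfl hRc ⟨n, ?_⟩ ?_
    · rwa [← map_top_of_surjective q hq, ← map_lowerCentralSeries]
    · rw [← map_top_of_surjective q hq, ← map_commutator]
      exact congrArg (map q) hn
  rintro z ⟨hzR, hz⟩
  rw [← QuotientGroup.eq_one_iff, ← mem_bot, ← inf_upperCentralSeries_eq_bot hc m]
  exact ⟨⟨z, hzR, rfl⟩, upperCentralSeries.map hq m ⟨z, hz, rfl⟩⟩

end Subgroup

/-! ### Central extensions and groups normally generated by an image of `Γ`. -/

/-- A group whose center has finite index has only finitely many commutators. -/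
theorem finite_commutatorSet_of_finiteIndex_center (G : Type*) [Group G] [(center G).FiniteIndex] :
    Finite (commutatorSet G) := by
  -- Central factors do not change a commutator, so coset representatives already give all of them.
  refine Set.Finite.subset (Set.finite_range
    fun x : (G ⧸ center G) × (G ⧸ center G) => ⁅x.1.out, x.2.out⁆) ?_
  rintro _ ⟨a, b, rfl⟩
  refine ⟨(a, b), ?_⟩
  obtain ⟨⟨z, hz⟩, ha⟩ := QuotientGroup.mk_out_eq_mul (center G) a
  obtain ⟨⟨w, hw⟩, hb⟩ := QuotientGroup.mk_out_eq_mul (center G) b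
  change ⁅(a : G ⧸ center G).out, (b : G ⧸ center G).out⁆ = _
  have hz' := mem_center_iff.mp hz
  have hw' := mem_center_iff.mp hw
  rw [ha, hb, commutatorElement_mul_right_eq_mul_conj, commutatorElement_mul_left_eq_conj_mul,
    commutatorElement_eq_one_iff_mul_comm.mpr (hz' b).symm,
    commutatorElement_eq_one_iff_mul_comm.mpr (hw' _)]
  simp

/-- Each map with central kernel costs one step of the upper central series; this makes the kernel
of the composite down to `G` hypercentral. -/
theorem comap_upperCentralSeries_le_of_ker_le_center {G H : Type*} [Group G] [Group H] {f : G →* H}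
    (hf : f.ker ≤ center G) (n : ℕ) :
    (Subgroup.upperCentralSeries H n).comap f ≤ Subgroup.upperCentralSeries G (n + 1) := by
  induction n with
  | zero => rwa [zero_add, Subgroup.upperCentralSeries_one]
  | succ n ih =>
    intro x hx
    refine Subgroup.mem_upperCentralSeries_succ_iff.mpr fun y => ih ?_
    rw [mem_comap, map_commutatorElement]
    exact Subgroup.mem_upperCentralSeries_succ_iff.mp hx (f y)

section NormalClosureRange

variable {Γ : Type*} {H : Type*} [Group Γ] [Group H]

/-- If the image of `Γ` is not contained in a proper normal subgroup of `H`, then `Γ` maps onto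
every nilpotent quotient of `H`. -/
theorem surjective_mk_lowerCentralSeries_comp {c : Γ →* H}
    (hc : normalClosure (Set.range c) = ⊤) (n : ℕ) :
    Function.Surjective
      ((QuotientGroup.mk' ((⊤ : Subgroup H).lowerCentralSeries n)).comp c) := by
  have h := sup_lowerCentralSeries_eq_top (L := c.range) (by rwa [MonoidHom.coe_range]) n
  have h' := congrArg (map (QuotientGroup.mk' ((⊤ : Subgroup H).lowerCentralSeries n))) h
  rw [Subgroup.map_sup, QuotientGroup.map_mk'_self, sup_bot_eq,
    map_top_of_surjective _ (QuotientGroup.mk'_surjective _), ← MonoidHom.range_comp] at h'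
  exact MonoidHom.range_eq_top.mp h'

theorem finite_of_normalClosure_range_eq_top [Finite Γ] [(center H).FiniteIndex] {c : Γ →* H}
    (hc : normalClosure (Set.range c) = ⊤) : Finite H := by
  -- By Schur's theorem the derived subgroup is finite, and the abelianization is an image of `Γ`.
  have := finite_commutatorSet_of_finiteIndex_center H
  have h1 : Finite ((⊤ : Subgroup H).lowerCentralSeries 1) :=
    inferInstanceAs (Finite (commutator H))
  have h2 := Finite.of_surjective _ (surjective_mk_lowerCentralSeries_comp hc 1)
  exact Finite.of_subgroup_quotient ((⊤ : Subgroup H).lowerCentralSeries 1)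

end NormalClosureRange

/-! ### The order bound. -/

/-- Used with `n = |N|` and `t = |R : N|`. With `v = v_p g`, the exponent of `p` in `n * t` is at
most `v (v + 1) / 2`. If `q` is the least prime factor of `g`, then `q ^ v ≤ p ^ v ≤ g`, so `v ≤
log_q g`; multiply over `p`. -/
theorem mul_le_towerBound {n t g : ℕ} (hn : n ≠ 0) (hg : g ≠ 0) (ht : t ∣ g)
    (h : ∀ p, n.factorization p ≤ (t.factorization p).choose 2) :
    ((n * t : ℕ) : ℝ) ≤ towerBound g := by
  have ht0 : t ≠ 0 := ne_zero_of_dvd_ne_zero hg ht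
  set L := Real.logb g.minFac g with hL
  have hfac (p : ℕ) : (n * t).factorization p ≤ (g.factorization p + 1).choose 2 := by
    rw [Nat.factorization_mul hn ht0, Finsupp.add_apply]
    calc n.factorization p + t.factorization p
        ≤ (t.factorization p).choose 2 + t.factorization p := by gcongr; exact h p
      _ = (t.factorization p + 1).choose 2 := by
          rw [Nat.choose_succ_succ' _ 1, Nat.choose_one_right, add_comm]
      _ ≤ _ := Nat.choose_le_choose 2
          (by gcongr; exact (Nat.factorization_le_iff_dvd ht0 hg).mpr ht p)
  have hsupp : (n * t).factorization.support ⊆ g.factorization.support := fun p hp => by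
    rw [Finsupp.mem_support_iff] at hp ⊢
    intro h0
    have := hfac p
    rw [h0] at this
    exact hp (Nat.le_zero.mp this)
  have hprod : (n * t : ℕ) = ∏ p ∈ g.factorization.support, p ^ (n * t).factorization p := by
    conv_lhs => rw [← Nat.prod_factorization_pow_eq_self (mul_ne_zero hn ht0)]
    exact Finsupp.prod_of_support_subset _ hsupp _ fun _ _ => pow_zero _
  have hgprod : (g : ℝ) = ∏ p ∈ g.factorization.support, ((p : ℝ) ^ g.factorization p) := by
    conv_lhs => rw [← Nat.prod_factorization_pow_eq_self hg]
    simp [Finsupp.prod]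
  rw [towerBound, ← hL, hprod, Nat.cast_prod]
  conv_rhs => rw [hgprod]
  rw [← Real.finsetProd_rpow _ _ fun p _ => by positivity]
  refine Finset.prod_le_prod (fun p _ => by positivity) fun p hp => ?_
  rw [Nat.support_factorization] at hp
  have hpp := Nat.prime_of_mem_primeFactors hp
  have hp1 : (1 : ℝ) ≤ p := by exact_mod_cast hpp.one_le
  have hg1 : g ≠ 1 := by
    rintro rfl
    simp at hp
  have hq := Nat.minFac_prime hg1
  have hvL : (g.factorization p : ℝ) ≤ L := by
    rw [hL, Real.le_logb_iff_rpow_le (by exact_mod_cast hq.one_lt)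
      (by exact_mod_cast Nat.pos_of_ne_zero hg), Real.rpow_natCast]
    calc (g.minFac : ℝ) ^ g.factorization p ≤ (p : ℝ) ^ g.factorization p := by
          gcongr
          exact Nat.minFac_le_of_dvd hpp.two_le (Nat.dvd_of_mem_primeFactors hp)
      _ ≤ g := by exact_mod_cast Nat.ordProj_le p hg
  calc ((p ^ (n * t).factorization p : ℕ) : ℝ)
      ≤ (p : ℝ) ^ (g.factorization p + 1).choose 2 := by
        push_cast
        exact pow_le_pow_right₀ hp1 (hfac p)
    _ = ((p : ℝ) ^ g.factorization p) ^ (((g.factorization p : ℝ) + 1) / 2) := by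
        rw [← Real.rpow_natCast, ← Real.rpow_natCast, ← Real.rpow_mul (by positivity),
          Nat.cast_choose_two]
        congr 1
        push_cast
        ring
    _ ≤ _ := Real.rpow_le_rpow_of_exponent_le (one_le_pow₀ hp1) (by linarith)

/-- Bound for a finite group `H` that is normally generated by an image of `Γ` and maps onto `G`
with hypercentral kernel. -/
theorem card_le_card_mul_towerBound {Γ G H : Type u} [Group Γ] [Group G] [Group H] [Finite Γ]
    [Finite G] [Finite H] {c : Γ →* H} (hc : normalClosure (Set.range c) = ⊤) (f : H →* G) {m : ℕ}
    (hm : f.ker ≤ Subgroup.upperCentralSeries H m) :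
    (Nat.card H : ℝ) ≤ (Nat.card Γ : ℝ) * towerBound (Nat.card G) := by
  obtain ⟨k, hk⟩ := WellFoundedLT.antitone_chain_condition
    (Subgroup.lowerCentralSeries_antitone (⊤ : Subgroup H))
  -- Large enough for the lower central series to be stationary and for `f.ker` to lie in the upper
  -- central term `n + 1`.
  set n := max k m
  set R := (⊤ : Subgroup H).lowerCentralSeries n with hR
  have hstat : (⊤ : Subgroup H).lowerCentralSeries (n + 1) = R :=
    (hk _ (by omega)).symm.trans (hk _ (le_max_left k m))
  set N := f.ker.subgroupOf R with hN
  have hNc : N ≤ center R := by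
    intro z hz
    have h := commutator_lowerCentralSeries_upperCentralSeries n H
    rw [commutator_eq_bot_iff_le_centralizer] at h
    refine mem_center_iff.mpr fun r => Subtype.ext ?_
    exact (mem_centralizer_iff.mp (h r.2) z
      (Subgroup.upperCentralSeries_mono H (by omega : m ≤ n + 1) (hm hz))).symm
  have hN' : N ≤ commutator R := by
    intro z hz
    have h := lowerCentralSeries_inf_upperCentralSeries_le hstat m ⟨z.2, hm hz⟩
    rw [← hR, ← map_subtype_commutator] at h
    obtain ⟨w, hw, hwz⟩ := h
    rwa [← Subtype.ext hwz]
  have hNi : N.index = Nat.card (R.map f) := by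
    rw [hN, subgroupOf, MonoidHom.comap_ker, index_ker, MonoidHom.range_comp, range_subtype]
  have hRcard : (Nat.card R : ℝ) ≤ towerBound (Nat.card G) := by
    rw [← N.card_mul_index]
    refine mul_le_towerBound Nat.card_pos.ne' Nat.card_pos.ne' ?_
      (factorization_card_le_choose hNc hN')
    rw [hNi]
    exact card_subgroup_dvd_card _
  have hRi : R.index ≤ Nat.card Γ :=
    Nat.card_le_card_of_surjective _ (surjective_mk_lowerCentralSeries_comp hc n)
  rw [← R.index_mul_card, Nat.cast_mul]
  gcongr

/-! ### Application to the tower. -/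

namespace FreeNormalClosure

variable {Γ G : Type u} [Group Γ] [Group G] (φ : Γ →* G)

theorem proj_comp_incl : (proj φ).comp (incl φ) = φ := (isFreeNormalClosure φ).1

theorem ker_proj_le_center : (proj φ).ker ≤ center (FreeNormalClosure φ) := by
  intro a ha
  refine mem_center_iff.mpr fun b => ?_
  have h := (normalStructure φ).act_map b a
  rw [MonoidHom.mem_ker.mp ha, map_one, MulAut.one_apply] at h
  exact mul_inv_eq_iff_eq_mul.mp h.symm |>.symm

/-- The action lifts conjugation, so the image is normal; it contains the image of `φ`. -/
theorem proj_surjective (hφ : normalClosure (Set.range φ) = ⊤) :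
    Function.Surjective (proj φ) := by
  have hn : (proj φ).range.Normal := ⟨by
    rintro _ ⟨a, rfl⟩ g
    exact ⟨act φ g a, (normalStructure φ).map_act g a⟩⟩
  rw [← MonoidHom.range_eq_top, ← top_le_iff, ← hφ]
  refine normalClosure_le_normal ?_
  rintro _ ⟨γ, rfl⟩
  exact ⟨incl φ γ, DFunLike.congr_fun (proj_comp_incl φ) γ⟩

/-- Since `proj φ` is onto, the action of any `g` is conjugation by a preimage of `g`, so every
generator `mk φ γ g` is conjugate to `incl φ γ`. -/
theorem normalClosure_range_incl (hφ : normalClosure (Set.range φ) = ⊤) :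
    normalClosure (Set.range (incl φ)) = ⊤ := by
  set N := normalClosure (Set.range (incl φ))
  have h : QuotientGroup.mk' N = 1 := by
    refine hom_ext φ fun γ g => ?_
    obtain ⟨b, rfl⟩ := proj_surjective φ hφ g
    have h1 : mk φ γ (proj φ b) = b * incl φ γ * b⁻¹ := by
      rw [← (normalStructure φ).act_map (incl φ γ) b]
      exact (by simp : mk φ γ (proj φ b) = act φ (proj φ b) (mk φ γ 1))
    rw [h1]
    exact (QuotientGroup.eq_one_iff _).mpr
      (normalClosure_normal.conj_mem _ (subset_normalClosure (Set.mem_range_self γ)) b)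
  rw [← QuotientGroup.ker_mk' N, h, MonoidHom.ker_one]

end FreeNormalClosure

namespace normalClosuresTower

open FreeNormalClosure

variable {Γ G : Type u} [Group Γ] [Group G]

theorem normalClosure_range_hom {φ : Γ →* G} (hφ : normalClosure (Set.range φ) = ⊤) (i : ℕ) :
    normalClosure (Set.range (normalClosuresTower φ i).hom) = ⊤ := by
  induction i with
  | zero => exact hφ
  | succ i ih => exact normalClosure_range_incl _ ih

theorem map_surjective {φ : Γ →* G} (hφ : normalClosure (Set.range φ) = ⊤) (i : ℕ) :
    Function.Surjective (map φ i) :=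
  proj_surjective _ (normalClosure_range_hom hφ i)

theorem finite_carrier [Finite Γ] [Finite G] {φ : Γ →* G}
    (hφ : normalClosure (Set.range φ) = ⊤) (i : ℕ) : Finite (normalClosuresTower φ i).carrier := by
  induction i with
  | zero => assumption
  | succ i ih =>
    have hle : (map φ i).ker ≤ center (normalClosuresTower φ (i + 1)).carrier :=
      ker_proj_le_center _
    have : (center (normalClosuresTower φ (i + 1)).carrier).FiniteIndex :=
      finiteIndex_of_le hle
    exact finite_of_normalClosure_range_eq_top (normalClosure_range_hom hφ (i + 1))

/-- The composite of the normal maps from the stage `i` of the tower to `G` has hypercentral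
kernel. -/
theorem exists_ker_le_upperCentralSeries (φ : Γ →* G)
    (i : ℕ) : ∃ f : (normalClosuresTower φ i).carrier →* G,
      f.ker ≤ Subgroup.upperCentralSeries (normalClosuresTower φ i).carrier i := by
  induction i with
  | zero => exact ⟨MonoidHom.id G, MonoidHom.ker_id.le⟩
  | succ i ih =>
    obtain ⟨f, hf⟩ := ih
    exact ⟨f.comp (map φ i), (comap_mono hf).trans
      (comap_upperCentralSeries_le_of_ker_le_center (ker_proj_le_center _) i)⟩

end normalClosuresTower

theorem mainTheorem1 {Γ G : Type u} [Group Γ] [Group G] [Finite Γ] [Finite G] (φ : Γ →* G)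
    (hφ : Subgroup.normalClosure (Set.range φ) = ⊤) :
    (∃ N : ℕ, ∀ i : ℕ, N ≤ i → Function.Bijective (normalClosuresTower.map φ i)) ∧
    ∀ i : ℕ, Finite (normalClosuresTower φ i).carrier ∧
      (Nat.card (normalClosuresTower φ i).carrier : ℝ) ≤
        (Nat.card Γ : ℝ) * towerBound (Nat.card G) := by
  have hfin := normalClosuresTower.finite_carrier hφ
  have hsurj := normalClosuresTower.map_surjective hφ
  have hbound (i : ℕ) : (Nat.card (normalClosuresTower φ i).carrier : ℝ) ≤
      (Nat.card Γ : ℝ) * towerBound (Nat.card G) := by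
    obtain ⟨f, hf⟩ := normalClosuresTower.exists_ker_le_upperCentralSeries φ i
    exact card_le_card_mul_towerBound (normalClosuresTower.normalClosure_range_hom hφ i) f hf
  refine ⟨?_, fun i => ⟨hfin i, hbound i⟩⟩
  have hmono : Monotone fun i => Nat.card (normalClosuresTower φ i).carrier :=
    monotone_nat_of_le_succ fun i => Nat.card_le_card_of_surjective _ (hsurj i)
  -- The real bound is rounded down to bound the orders in `ℕ`.
  obtain ⟨b, N, hN⟩ := converges_of_monotone_of_bounded hmono fun i =>
    Nat.le_floor (hbound i)
  exact ⟨N, fun i hi => (Nat.bijective_iff_surjective_and_card _).mpr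
    ⟨hsurj i, (hN (i + 1) (by omega)).trans (hN i hi).symm⟩⟩
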